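/- Let $d \ge 0$ and $L \ge 1$ be integers, let $S=\{-1,1\}^{\mathbb Z^d}$ carry the product $\sigma$-algebra, and let $|\cdot|$ be the maximum norm on $\mathbb Z^d$. Let $B^L(i)=\{j\in\mathbb Z^d : |i-j|\le L\}$. A pairwise potential is a family $J=\{J(i,j) : i,j\in\mathbb Z^d\}$ of real numbers with $J(i,i)=0$, $J(i,j)=J(j,i)$ and $\sup_i\sum_j|J(i,j)|<\infty$. An Ising model with potential $J$ is a random element $X$ of $S$ such that, for every $i\in\mathbb Z^d$ and $a\in\{-1,1\}$, $$\mathbb P\bigl(X(i)=a \,\big|\, X(j),\, j\ne i\bigr)=\frac{1}{1+\exp\bigl(-2\sum_{j\in\mathbb Z^d}J(i,j)\,a\,X(j)\bigr)}\quad\text{almost surely.}$$ The truncated potential $J^L$ is given by $J^L(i,j)=J(i,j)$ if $|i-j|\le L$ and $J^L(i,j)=0$ otherwise. A coupling between random elements $X$ and $X^L$ of $S$ is a random element $(\tilde X,\tilde X^L)$ of $S\times S$ such that $\tilde X$ has the law of $X$ and $\tilde X^L$ has the law of $X^L$. Theorem. Let $J$ be a pairwise potential with $$\sup_{i\in\mathbb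 Z^d}\sum_{j\in\mathbb Z^d}|J(i,j)|=r<1 .$$ Then Ising models with potential $J$ and with potential $J^L$ exist and, whenever $X$ is an Ising model with potential $J$ and $X^L$ is an Ising model with potential $J^L$, there is a coupling $(\tilde X,\tilde X^L)$ between $X$ and $X^L$ such that, for every $i\in\mathbb Z^d$ simultaneously, $$\mathbb P\bigl(\tilde X(i)\ne\tilde X^L(i)\bigr)\le\frac{1}{1-r}\,\sup_{k\in\mathbb Z^d}\ \sum_{j\in\mathbb Z^d\setminus B^L(k)}|J(k,j)| .$$ -/

import Mathlib

open MeasureTheory ProbabilityTheory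

noncomputable section

/-- The sites of the lattice `ℤ^d`. The norm of Mathlib on this type is the maximum norm. -/
abbrev Site (d : ℕ) : Type := Fin d → ℤ

/-- Spin configurations `S = {-1, 1}^(ℤ^d)`, with the product `σ`-algebra.
The units of `ℤ` are exactly `-1` and `1`. -/
abbrev Config (d : ℕ) : Type := Site d → ℤˣ

/-- The value of a spin, as a real number. -/
def spinVal (a : ℤˣ) : ℝ := ((a : ℤ) : ℝ)

/-- The ball `B^L(i)` of radius `L` around the site `i`, for the maximum norm. -/
def siteBall {d : ℕ} (L : ℕ) (i : Site d) : Set (Site d) := {j | ‖i - j‖ ≤ (L : ℝ)}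

/-- `J` is a pairwise potential: it vanishes on the diagonal, is symmetric, and
`sup_i ∑_j |J(i,j)| < ∞` (each sum converges and the sums are bounded). -/
structure IsPairwisePotential {d : ℕ} (J : Site d → Site d → ℝ) : Prop where
  diag : ∀ i, J i i = 0
  symm : ∀ i j, J i j = J j i
  summable : ∀ i, Summable fun j => |J i j|
  bdd : BddAbove (Set.range fun i => ∑' j, |J i j|)

open Classical in
/-- The truncated potential `J^L`. -/
def truncPotential {d : ℕ} (L : ℕ) (J : Site d → Site d → ℝ) : Site d → Site d → ℝ :=
  fun i j => if j ∈ siteBall L i then J i j else 0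

/-- The `σ`-algebra on configurations generated by the coordinates `x(j)`, `j ≠ i`. -/
abbrev offSite {d : ℕ} (i : Site d) : MeasurableSpace (Config d) :=
  MeasurableSpace.comap (fun (x : Config d) (j : {j : Site d // j ≠ i}) => x j) inferInstance

/-- The single-site conditional probability `1 / (1 + exp (-2 ∑_j J(i,j) a x(j)))`. -/
def localSpec {d : ℕ} (J : Site d → Site d → ℝ) (i : Site d) (a : ℤˣ) (x : Config d) : ℝ :=
  1 / (1 + Real.exp (-2 * ∑' j, J i j * spinVal a * spinVal (x j)))

/-- `μ` is the distribution of an Ising model with potential `J`: for each site `i` and spin `a`,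
`localSpec J i a` is a version of the conditional probability of `x(i) = a` given all the
`x(j)`, `j ≠ i`. -/
def IsIsingLaw {d : ℕ} (J : Site d → Site d → ℝ) (μ : Measure (Config d)) : Prop :=
  ∀ (i : Site d) (a : ℤˣ), μ⟦{x : Config d | x i = a} | offSite i⟧ =ᵐ[μ] localSpec J i a

/-- The random element `X`, defined on a space with probability `P`, is an Ising model with
potential `J`. -/
def IsIsingModel {d : ℕ} {Ω : Type*} [MeasurableSpace Ω] (J : Site d → Site d → ℝ)
    (P : Measure Ω) (X : Ω → Config d) : Prop :=
  Measurable X ∧ IsIsingLaw J (P.map X)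

/-- The random element `Z = (X̃, Ỹ)` of `S × S` (under `Q`) is a coupling between `X` (under `P`)
and `Y` (under `P'`). -/
structure IsCoupling {d : ℕ} {Ω Ω' Ω₀ : Type*} [MeasurableSpace Ω] [MeasurableSpace Ω']
    [MeasurableSpace Ω₀] (P : Measure Ω) (X : Ω → Config d) (P' : Measure Ω') (Y : Ω' → Config d)
    (Q : Measure Ω₀) (Z : Ω₀ → Config d × Config d) : Prop where
  measurable : Measurable Z
  fst : Q.map (fun ω => (Z ω).1) = P.map X
  snd : Q.map (fun ω => (Z ω).2) = P'.map Y

end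

/-!
A law on configurations is that of an Ising model exactly when it is invariant under the heat-bath
update at every site, in which the spin at `i` is redrawn from its conditional law given the other
spins.

Updating both components of a coupling at `i` with one uniform variable gives another coupling of
the same laws. It changes only the disagreement probability at `i`, which becomes the mean distance
between the two conditional probabilities. The couplings form a compact set, so one of them is
Pareto-minimal for the family of all disagreement probabilities `w i`, and no update can lower any
of these. The map `t ↦ 1 / (1 + exp (-2 t))` is `1/2`-Lipschitz, hence
`w i ≤ ∑ j, |J i j| * w j + ∑ j, |J i j - K i j|`. The supremum of the `w i` is finite, so this
inequality bounds it when the rows of `|J|` have sums at most `r < 1`.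

Existence holds without a smallness condition. For finitely many sites, some law with a continuous
log-density relative to independent fair spins is invariant under their updates. Invariance under
the update at a given site is a closed condition on laws, and the space of laws is compact.
-/

section

open Set Filter Topology Function
open scoped unitInterval ENNReal

instance discreteMeasurableSpace_intUnits : DiscreteMeasurableSpace ℤˣ where
  forall_measurableSet s :=
    ⟨Units.val '' s, .of_discrete, preimage_image_eq _ Units.val_injective⟩

section Coupling

theorem exists_minimalFor_of_isCompact {X α : Type*} [TopologicalSpace X] [Preorder α] {K : Set X}
    (hK : IsCompact K) (hne : K.Nonempty) {f : X → α} (hf : ∀ a, IsClosed {x | f x ≤ a}) :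
    ∃ x, MinimalFor (· ∈ K) f x := by
  have chain_bounded (c : Set K) (hc : IsChain (fun x y : K => f y ≤ f x) c) (hcne : c.Nonempty) :
      ∃ y : K, ∀ x ∈ c, f y ≤ f x := by
    have := hcne.to_subtype
    obtain ⟨y, hyK, hy⟩ := hK.inter_iInter_nonempty (fun x : c => {y | f y ≤ f x.1})
      (fun x => hf _) fun u => by
        obtain ⟨z, hz⟩ := (directedOn_iff_directed.1 hc.directedOn).finset_le
          (r := fun x y : c => f y.1 ≤ f x.1) u
        exact ⟨z.1, z.1.2, mem_iInter₂.2 hz⟩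
    exact ⟨⟨y, hyK⟩, fun x hx => mem_iInter.1 hy ⟨x, hx⟩⟩
  have := hne.to_subtype
  obtain ⟨m, hm⟩ := exists_maximal_of_nonempty_chains_bounded chain_bounded
    fun hxy hyz => hyz.trans hxy
  exact ⟨m, m.2, fun y hy hym => hm ⟨y, hy⟩ hym⟩

variable {X Y : Type*} [MeasurableSpace X] [MeasurableSpace Y]

/-- The probability measures on `X × Y` with marginals `μ` and `ν`. -/
def couplings (μ : ProbabilityMeasure X) (ν : ProbabilityMeasure Y) :
    Set (ProbabilityMeasure (X × Y)) :=
  {π | MeasurePreserving Prod.fst π.toMeasure μ.toMeasure ∧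
    MeasurePreserving Prod.snd π.toMeasure ν.toMeasure}

theorem couplings_nonempty (μ : ProbabilityMeasure X) (ν : ProbabilityMeasure Y) :
    (couplings μ ν).Nonempty :=
  ⟨μ.prod ν, measurePreserving_fst, measurePreserving_snd⟩

variable [TopologicalSpace X] [TopologicalSpace Y]

theorem isClosed_setOf_measurePreserving [OpensMeasurableSpace X] [BorelSpace Y]
    [HasOuterApproxClosed Y] {f : X → Y} (hf : Continuous f) (ν : ProbabilityMeasure Y) :
    IsClosed {μ : ProbabilityMeasure X | MeasurePreserving f μ.toMeasure ν.toMeasure} := by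
  have hmap : {μ : ProbabilityMeasure X | MeasurePreserving f μ.toMeasure ν.toMeasure} =
      {μ | μ.map hf.aemeasurable = ν} := by
    ext μ
    exact ⟨fun h => Subtype.ext h.map_eq, fun h => ⟨hf.measurable, congrArg Subtype.val h⟩⟩
  rw [hmap]
  exact isClosed_eq (ProbabilityMeasure.continuous_map hf) continuous_const

theorem isClosed_couplings [BorelSpace X] [BorelSpace Y] [OpensMeasurableSpace (X × Y)]
    [HasOuterApproxClosed X] [HasOuterApproxClosed Y] (μ : ProbabilityMeasure X)
    (ν : ProbabilityMeasure Y) : IsClosed (couplings μ ν) :=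
  (isClosed_setOf_measurePreserving continuous_fst μ).inter
    (isClosed_setOf_measurePreserving continuous_snd ν)

theorem isClosed_setOf_forall_measure_le [OpensMeasurableSpace X] [HasOuterApproxClosed X]
    {κ : Type*} {E : κ → Set X} (hE : ∀ k, IsClopen (E k)) (a : κ → ℝ≥0∞) :
    IsClosed {μ : ProbabilityMeasure X | (fun k => μ.toMeasure (E k)) ≤ a} := by
  simp only [Pi.le_def, ofPred_forall]
  refine isClosed_iInter fun k => isClosed_le ?_ continuous_const
  simp only [← ProbabilityMeasure.ennreal_coeFn_eq_coeFn_toMeasure]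
  exact ENNReal.continuous_coe.comp (continuous_iff_continuousAt.2 fun μ =>
    ProbabilityMeasure.tendsto_measure_of_isClopen_of_tendsto tendsto_id (hE k))

theorem exists_minimalFor_couplings [T2Space X] [T2Space Y] [BorelSpace X] [BorelSpace Y]
    [CompactSpace X] [CompactSpace Y] [SecondCountableTopology X] [SecondCountableTopology Y]
    (μ : ProbabilityMeasure X) (ν : ProbabilityMeasure Y) {κ : Type*} {E : κ → Set (X × Y)}
    (hE : ∀ k, IsClopen (E k)) :
    ∃ π, MinimalFor (· ∈ couplings μ ν) (fun π k => π.toMeasure (E k)) π :=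
  exists_minimalFor_of_isCompact (isClosed_couplings μ ν).isCompact (couplings_nonempty μ ν)
    (isClosed_setOf_forall_measure_le hE)

end Coupling

section HeatBath

/-- The spin read off from the uniform variable `u` so as to be `1` with probability `t`. -/
noncomputable def thresholdSpin (t u : I) : ℤˣ := if u ≤ t then 1 else -1

theorem volume_thresholdSpin_ne (t s : I) :
    volume {u | thresholdSpin t u ≠ thresholdSpin s u} = edist t s := by
  have hset : {u | thresholdSpin t u ≠ thresholdSpin s u} = uIoc s t := by
    ext u
    by_cases ht : u ≤ t <;> by_cases hs : u ≤ s <;>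
      simp [thresholdSpin, mem_uIoc, ht, hs, not_le.mp]
  rw [hset, unitInterval.volume_uIoc]

theorem measurable_thresholdSpin : Measurable fun z : I × I => thresholdSpin z.1 z.2 :=
  Measurable.ite (measurableSet_le measurable_snd measurable_fst) measurable_const measurable_const

theorem volume_real_thresholdSpin_one (t : I) : volume.real {u | thresholdSpin t u = 1} = t := by
  have hset : {u | thresholdSpin t u = 1} = Iic t := by
    ext u
    by_cases hu : u ≤ t <;> simp [thresholdSpin, hu]
  rw [hset, measureReal_def, unitInterval.volume_Iic, ENNReal.toReal_ofReal t.2.1]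

theorem volume_real_thresholdSpin_neg_one (t : I) :
    volume.real {u | thresholdSpin t u = -1} = 1 - t := by
  have hset : {u | thresholdSpin t u = -1} = Ioi t := by
    ext u
    by_cases hu : u ≤ t <;> simp [thresholdSpin, hu, not_lt.2, not_le.1]
  rw [hset, measureReal_def, unitInterval.volume_Ioi, ENNReal.toReal_ofReal (sub_nonneg.2 t.2.2)]

theorem integral_thresholdSpin (t : I) (g : ℤˣ → ℝ) :
    ∫ u, g (thresholdSpin t u) = t * g 1 + (1 - t) * g (-1) := by
  have hsplit : (fun u => g (thresholdSpin t u)) =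
      (Iic t).indicator (fun _ => g 1) + (Ioi t).indicator fun _ => g (-1) := by
    ext u
    by_cases hu : u ≤ t <;> simp [thresholdSpin, hu, not_lt.2, not_le.1]
  have hpos : (0 : ℝ) ≤ 1 - t := sub_nonneg.2 t.2.2
  rw [hsplit, integral_add' ((integrable_const _).indicator measurableSet_Iic)
      ((integrable_const _).indicator measurableSet_Ioi),
    integral_indicator_const _ measurableSet_Iic, integral_indicator_const _ measurableSet_Ioi]
  simp [Measure.real, t.2.1, hpos]

variable {ι : Type*} [DecidableEq ι] {i : ι} {p q : (ι → ℤˣ) → I}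

/-- The heat-bath update of a configuration at the site `i`: driven by a uniform variable, the spin
at `i` is redrawn to be `1` with probability `p x`, where `x` is the current configuration. -/
noncomputable def resample (i : ι) (p : (ι → ℤˣ) → I) (z : (ι → ℤˣ) × I) : ι → ℤˣ :=
  update z.1 i (thresholdSpin (p z.1) z.2)

theorem measurable_resample (i : ι) (hp : Measurable p) : Measurable (resample i p) :=
  measurable_update'.comp <| measurable_fst.prodMk <|
    measurable_thresholdSpin.comp ((hp.comp measurable_fst).prodMk measurable_snd)

/-- Two configurations resampled at `i` with the same uniform variable. -/
noncomputable def resamplePair (i : ι) (p q : (ι → ℤˣ) → I)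
    (z : ((ι → ℤˣ) × (ι → ℤˣ)) × I) : (ι → ℤˣ) × (ι → ℤˣ) :=
  (resample i p (z.1.1, z.2), resample i q (z.1.2, z.2))

/-- A law is stationary if resampling any one spin, the one at `i` with the probability `p i`,
leaves it unchanged. -/
def IsHeatBathStationary (p : ι → (ι → ℤˣ) → I) (μ : Measure (ι → ℤˣ)) : Prop :=
  ∀ i, MeasurePreserving (resample i (p i)) (μ.prod volume) μ

/-- The event that the two configurations of a pair have different spins at `i`. -/
def disagreeAt (i : ι) : Set ((ι → ℤˣ) × (ι → ℤˣ)) := {z | z.1 i ≠ z.2 i}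

omit [DecidableEq ι] in
theorem isClopen_disagreeAt (i : ι) : IsClopen (disagreeAt i) :=
  (isClopen_discrete {a : ℤˣ × ℤˣ | a.1 ≠ a.2}).preimage
    (f := fun z : (ι → ℤˣ) × (ι → ℤˣ) => (z.1 i, z.2 i)) (by fun_prop)

omit [DecidableEq ι] in
theorem measurableSet_disagreeAt (i : ι) : MeasurableSet (disagreeAt i) :=
  (MeasurableSet.of_discrete (s := {a : ℤˣ × ℤˣ | a.1 ≠ a.2})).preimage
    (f := fun z : (ι → ℤˣ) × (ι → ℤˣ) => (z.1 i, z.2 i)) (by fun_prop)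

theorem measurable_resamplePair (hp : Measurable (resample i p)) (hq : Measurable (resample i q)) :
    Measurable (resamplePair i p q) := by
  unfold resamplePair
  fun_prop

theorem resamplePair_preimage_disagreeAt_of_ne {j : ι} (hj : j ≠ i) :
    resamplePair i p q ⁻¹' disagreeAt j = Prod.fst ⁻¹' disagreeAt j := by
  ext z
  simp [resamplePair, resample, disagreeAt, hj]

theorem measure_resamplePair_disagreeAt (hp : Measurable (resample i p))
    (hq : Measurable (resample i q)) (π : Measure ((ι → ℤˣ) × (ι → ℤˣ))) :
    π.prod volume (resamplePair i p q ⁻¹' disagreeAt i) = ∫⁻ z, edist (p z.1) (q z.2) ∂π := by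
  rw [Measure.prod_apply ((measurable_resamplePair hp hq) (measurableSet_disagreeAt i))]
  simp only [← volume_thresholdSpin_ne, resamplePair, resample, disagreeAt, preimage_ofPred_eq,
    update_self]

theorem exists_mem_couplings_resample {μ ν : ProbabilityMeasure (ι → ℤˣ)}
    {π : ProbabilityMeasure ((ι → ℤˣ) × (ι → ℤˣ))} (hπ : π ∈ couplings μ ν)
    (hμ : MeasurePreserving (resample i p) (μ.toMeasure.prod volume) μ.toMeasure)
    (hν : MeasurePreserving (resample i q) (ν.toMeasure.prod volume) ν.toMeasure) :
    ∃ π' ∈ couplings μ ν, (∀ j ≠ i, π'.toMeasure (disagreeAt j) = π.toMeasure (disagreeAt j)) ∧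
      π'.toMeasure (disagreeAt i) = ∫⁻ z, edist (p z.1) (q z.2) ∂π.toMeasure := by
  have hmeas := measurable_resamplePair hμ.measurable hν.measurable
  let π' : ProbabilityMeasure ((ι → ℤˣ) × (ι → ℤˣ)) :=
    ⟨(π.toMeasure.prod volume).map (resamplePair i p q),
      Measure.isProbabilityMeasure_map hmeas.aemeasurable⟩
  have hπ' (j : ι) : π'.toMeasure (disagreeAt j) =
      π.toMeasure.prod volume (resamplePair i p q ⁻¹' disagreeAt j) :=
    Measure.map_apply hmeas (measurableSet_disagreeAt j)
  refine ⟨π', ⟨⟨measurable_fst, ?_⟩, ⟨measurable_snd, ?_⟩⟩, fun j hj => ?_, ?_⟩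
  · exact (Measure.map_map measurable_fst hmeas).trans
      (hμ.comp (hπ.1.prod (MeasurePreserving.id volume))).map_eq
  · exact (Measure.map_map measurable_snd hmeas).trans
      (hν.comp (hπ.2.prod (MeasurePreserving.id volume))).map_eq
  · rw [hπ', resamplePair_preimage_disagreeAt_of_ne hj]
    exact measurePreserving_fst.measure_preimage (measurableSet_disagreeAt j).nullMeasurableSet
  · rw [hπ', measure_resamplePair_disagreeAt hμ.measurable hν.measurable]

-- Resampling a Pareto-minimal coupling at `i` changes no other disagreement probability, hence
-- cannot decrease the one at `i`.
theorem exists_mem_couplings_disagreeAt_le [Countable ι] {p q : ι → (ι → ℤˣ) → I}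
    {μ ν : ProbabilityMeasure (ι → ℤˣ)} (hμ : IsHeatBathStationary p μ.toMeasure)
    (hν : IsHeatBathStationary q ν.toMeasure) :
    ∃ π ∈ couplings μ ν, ∀ i, π.toMeasure (disagreeAt i) ≤
      ∫⁻ z, edist (p i z.1) (q i z.2) ∂π.toMeasure := by
  obtain ⟨π, hπ, hmin⟩ := exists_minimalFor_couplings μ ν isClopen_disagreeAt
  refine ⟨π, hπ, fun i => ?_⟩
  obtain ⟨π', hπ', hother, hself⟩ := exists_mem_couplings_resample hπ (hμ i) (hν i)
  by_contra! hlt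
  rw [← hself] at hlt
  refine hlt.not_ge (hmin hπ' (fun j => ?_) i)
  obtain rfl | hj := eq_or_ne j i
  · exact hlt.le
  · exact (hother j hj).le

end HeatBath

section LocalField

variable {ι : Type*}

/-- The field `∑ j, a j * x j` that the spins of `x` exert on a site interacting with them through
the couplings `a`. -/
noncomputable def localField (a : ι → ℝ) (x : ι → ℤˣ) : ℝ := ∑' j, a j * spinVal (x j)

/-- The conditional probability of a spin `1` at a site subject to the local field of `x`. -/
noncomputable def plusProb (a : ι → ℝ) (x : ι → ℤˣ) : I := unitInterval.sigmoid (2 * localField a x)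

@[simp]
theorem spinVal_one : spinVal 1 = 1 := by simp [spinVal]

@[simp]
theorem spinVal_neg (s : ℤˣ) : spinVal (-s) = -spinVal s := by simp [spinVal]

@[simp]
theorem abs_spinVal (s : ℤˣ) : |spinVal s| = 1 := by
  obtain rfl | rfl := Int.units_eq_one_or s <;> simp

theorem summable_mul_spinVal {a : ι → ℝ} (ha : Summable a) (x : ι → ℤˣ) :
    Summable fun j => a j * spinVal (x j) :=
  .of_norm (by simpa [abs_mul] using ha.abs)

theorem lipschitzWith_sigmoid_two_mul :
    LipschitzWith 2⁻¹ fun t : ℝ => unitInterval.sigmoid (2 * t) := by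
  suffices h : LipschitzWith 2⁻¹ fun t : ℝ => Real.sigmoid (2 * t) from fun s t => h s t
  have hderiv (t : ℝ) : HasDerivAt (fun t => Real.sigmoid (2 * t))
      (Real.sigmoid (2 * t) * (1 - Real.sigmoid (2 * t)) * 2) t :=
    (Real.hasDerivAt_sigmoid (2 * t)).comp t (by simpa using (hasDerivAt_id t).const_mul 2)
  refine lipschitzWith_of_nnnorm_deriv_le (fun t => (hderiv t).differentiableAt) fun t => ?_
  have hpos := Real.sigmoid_nonneg (2 * t)
  have hle := sub_nonneg.2 (Real.sigmoid_le_one (2 * t))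
  rw [← NNReal.coe_le_coe, coe_nnnorm, (hderiv t).deriv, Real.norm_of_nonneg (by positivity)]
  push_cast
  nlinarith [sq_nonneg (Real.sigmoid (2 * t) - 1 / 2)]

theorem enorm_spinVal (s : ℤˣ) : ‖spinVal s‖ₑ = 1 := by
  rw [Real.enorm_eq_ofReal_abs, abs_spinVal, ENNReal.ofReal_one]

theorem enorm_mul_spinVal_sub_le (a b : ℝ) (z : (ι → ℤˣ) × (ι → ℤˣ)) (j : ι) :
    ‖a * spinVal (z.1 j) - b * spinVal (z.2 j)‖ₑ ≤
      2 * ((disagreeAt j).indicator (fun _ => ‖a‖ₑ) z + ‖a - b‖ₑ) := by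
  have hle : ‖a - b‖ₑ ≤ 2 * ‖a - b‖ₑ := le_mul_of_one_le_left zero_le one_le_two
  by_cases hxy : z ∈ disagreeAt j
  · calc ‖a * spinVal (z.1 j) - b * spinVal (z.2 j)‖ₑ
      _ = ‖((a - b) - (a + a)) * spinVal (z.2 j)‖ₑ := by
          rw [Int.units_ne_iff_eq_neg.1 hxy, spinVal_neg]
          ring_nf
      _ ≤ ‖a - b‖ₑ + ‖a + a‖ₑ := by
          rw [enorm_mul, enorm_spinVal, mul_one]
          exact enorm_sub_le
      _ ≤ 2 * ‖a - b‖ₑ + 2 * ‖a‖ₑ := by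
          rw [two_mul ‖a‖ₑ]
          gcongr
          exact enorm_add_le a a
      _ = _ := by rw [indicator_of_mem hxy, mul_add, add_comm]
  · rw [not_not.1 hxy, ← sub_mul, enorm_mul, enorm_spinVal, mul_one, indicator_of_notMem hxy,
      zero_add]
    exact hle

theorem edist_plusProb_le {a b : ι → ℝ} (ha : Summable a) (hb : Summable b)
    (z : (ι → ℤˣ) × (ι → ℤˣ)) :
    edist (plusProb a z.1) (plusProb b z.2) ≤
      ∑' j, (disagreeAt j).indicator (fun _ => ‖a j‖ₑ) z + ∑' j, ‖a j - b j‖ₑ := by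
  have hterm (j : ι) : 2⁻¹ * ‖a j * spinVal (z.1 j) - b j * spinVal (z.2 j)‖ₑ ≤
      (disagreeAt j).indicator (fun _ => ‖a j‖ₑ) z + ‖a j - b j‖ₑ := by
    rw [ENNReal.inv_mul_le_iff two_ne_zero ENNReal.ofNat_ne_top]
    exact enorm_mul_spinVal_sub_le (a j) (b j) z j
  calc edist (plusProb a z.1) (plusProb b z.2)
    _ ≤ 2⁻¹ * edist (localField a z.1) (localField b z.2) := by
        simpa only [ENNReal.coe_inv_two, plusProb] using
          lipschitzWith_sigmoid_two_mul (localField a z.1) (localField b z.2)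
    _ = 2⁻¹ * ‖∑' j, (a j * spinVal (z.1 j) - b j * spinVal (z.2 j))‖ₑ := by
        rw [(summable_mul_spinVal ha z.1).tsum_sub (summable_mul_spinVal hb z.2),
          edist_eq_enorm_sub]
        rfl
    _ ≤ 2⁻¹ * ∑' j, ‖a j * spinVal (z.1 j) - b j * spinVal (z.2 j)‖ₑ := by
        gcongr
        exact enorm_tsum_le_tsum_enorm
    _ ≤ _ := by
        rw [← ENNReal.tsum_mul_left, ← ENNReal.tsum_add]
        exact ENNReal.tsum_le_tsum hterm

end LocalField

section Dobrushin

variable {ι : Type*} [Countable ι]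

theorem lintegral_edist_plusProb_le {a b : ι → ℝ} (ha : Summable a) (hb : Summable b)
    (π : ProbabilityMeasure ((ι → ℤˣ) × (ι → ℤˣ))) :
    ∫⁻ z, edist (plusProb a z.1) (plusProb b z.2) ∂π.toMeasure ≤
      ∑' j, ‖a j‖ₑ * π.toMeasure (disagreeAt j) + ∑' j, ‖a j - b j‖ₑ := by
  have hmeas (j : ι) : Measurable ((disagreeAt j).indicator fun _ => ‖a j‖ₑ) :=
    measurable_const.indicator (measurableSet_disagreeAt j)
  calc ∫⁻ z, edist (plusProb a z.1) (plusProb b z.2) ∂π.toMeasure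
    _ ≤ ∫⁻ z, (∑' j, (disagreeAt j).indicator (fun _ => ‖a j‖ₑ) z + ∑' j, ‖a j - b j‖ₑ)
          ∂π.toMeasure := lintegral_mono fun z => edist_plusProb_le ha hb z
    _ = _ := by
        rw [lintegral_add_right _ measurable_const, lintegral_const, measure_univ, mul_one,
          lintegral_tsum fun j => (hmeas j).aemeasurable]
        simp only [lintegral_indicator_const (measurableSet_disagreeAt _)]

omit [Countable ι] in
theorem tsum_enorm_eq_ofReal_tsum_abs {a : ι → ℝ} (ha : Summable a) :
    ∑' j, ‖a j‖ₑ = ENNReal.ofReal (∑' j, |a j|) := by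
  simp only [Real.enorm_eq_ofReal_abs,
    ENNReal.ofReal_tsum_of_nonneg (fun j => abs_nonneg (a j)) ha.abs]

omit [Countable ι] in
theorem le_div_of_forall_le_tsum_mul_add {J : ι → ι → ℝ≥0∞} {r δ : ℝ≥0∞} (hr : r < 1)
    (hJ : ∀ i, ∑' j, J i j ≤ r) {w : ι → ℝ≥0∞} (hw : ∀ i, w i ≤ 1)
    (h : ∀ i, w i ≤ ∑' j, J i j * w j + δ) (i : ι) : w i ≤ δ / (1 - r) := by
  set c := ⨆ j, w j
  have hc_top : c ≠ ∞ := ((iSup_le hw).trans_lt ENNReal.one_lt_top).ne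
  have hcr : c ≤ r * c + δ := iSup_le fun k => calc
    w k ≤ ∑' j, J k j * w j + δ := h k
    _ ≤ (∑' j, J k j) * c + δ := by
        rw [← ENNReal.tsum_mul_right]
        gcongr with j
        exact le_iSup w j
    _ ≤ r * c + δ := by gcongr; exact hJ k
  refine (le_iSup w i).trans ((ENNReal.le_div_iff_mul_le (.inl (tsub_pos_of_lt hr).ne')
    (.inl (ENNReal.sub_ne_top ENNReal.one_ne_top))).2 ?_)
  rw [mul_comm, ENNReal.sub_mul fun _ _ => hc_top, one_mul]
  exact tsub_le_iff_left.2 hcr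

theorem exists_mem_couplings_real_disagreeAt_le [DecidableEq ι] {J K : ι → ι → ℝ}
    (hJ : ∀ i, Summable (J i)) (hK : ∀ i, Summable (K i)) {r δ : ℝ}
    (hr : ∀ i, ∑' j, |J i j| ≤ r) (hr1 : r < 1) (hδ : ∀ i, ∑' j, |J i j - K i j| ≤ δ)
    {μ ν : ProbabilityMeasure (ι → ℤˣ)}
    (hμ : IsHeatBathStationary (fun i => plusProb (J i)) μ.toMeasure)
    (hν : IsHeatBathStationary (fun i => plusProb (K i)) ν.toMeasure) :
    ∃ π ∈ couplings μ ν, ∀ i, π.toMeasure.real (disagreeAt i) ≤ 1 / (1 - r) * δ := by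
  obtain ⟨π, hπ, hle⟩ := exists_mem_couplings_disagreeAt_le hμ hν
  refine ⟨π, hπ, fun i => ?_⟩
  have hδ0 : 0 ≤ δ := (tsum_nonneg fun j => abs_nonneg _).trans (hδ i)
  have hr0 : 0 ≤ r := (tsum_nonneg fun j => abs_nonneg _).trans (hr i)
  have dobrushin : π.toMeasure (disagreeAt i) ≤ ENNReal.ofReal δ / (1 - ENNReal.ofReal r) :=
    le_div_of_forall_le_tsum_mul_add (ENNReal.ofReal_lt_one.2 hr1)
      (fun k => (tsum_enorm_eq_ofReal_tsum_abs (hJ k)).trans_le (ENNReal.ofReal_le_ofReal (hr k)))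
      (fun _ => prob_le_one)
      (fun k => (hle k).trans <| (lintegral_edist_plusProb_le (hJ k) (hK k) π).trans <| by
        gcongr
        exact (tsum_enorm_eq_ofReal_tsum_abs ((hJ k).sub (hK k))).trans_le
          (ENNReal.ofReal_le_ofReal (hδ k))) i
  calc π.toMeasure.real (disagreeAt i)
    _ ≤ (ENNReal.ofReal δ / (1 - ENNReal.ofReal r)).toReal :=
        ENNReal.toReal_mono (ENNReal.div_ne_top ENNReal.ofReal_ne_top
          (tsub_pos_of_lt (ENNReal.ofReal_lt_one.2 hr1)).ne') dobrushin
    _ = 1 / (1 - r) * δ := by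
        rw [← ENNReal.ofReal_one, ← ENNReal.ofReal_sub _ hr0, ENNReal.toReal_div,
          ENNReal.toReal_ofReal hδ0, ENNReal.toReal_ofReal (sub_nonneg.2 hr1.le),
          one_div_mul_eq_div]

end Dobrushin

section GibbsMeasure

variable {ι : Type*} [DecidableEq ι]

/-- The expectation of `f` after the spin of `x` at `i` is redrawn to be `1` with probability
`p x`. -/
def heatBath (i : ι) (p : (ι → ℤˣ) → I) (f : (ι → ℤˣ) → ℝ) (x : ι → ℤˣ) : ℝ :=
  p x * f (update x i 1) + (1 - p x) * f (update x i (-1))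

variable {i : ι} {p : (ι → ℤˣ) → I}

theorem continuous_heatBath (i : ι) (hp : Continuous p) {f : (ι → ℤˣ) → ℝ} (hf : Continuous f) :
    Continuous (heatBath i p f) := by
  unfold heatBath
  fun_prop

variable [Countable ι]

theorem integral_comp_resample (hp : Measurable p) (μ : Measure (ι → ℤˣ)) [IsFiniteMeasure μ]
    (f : C(ι → ℤˣ, ℝ)) :
    ∫ z, f (resample i p z) ∂μ.prod volume = ∫ x, heatBath i p f x ∂μ := by
  have hint : Integrable (fun z => f (resample i p z)) (μ.prod volume) :=
    .of_bound (f.continuous.measurable.comp (measurable_resample i hp)).aestronglyMeasurable ‖f‖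
      (ae_of_all _ fun z => f.norm_coe_le_norm _)
  rw [integral_prod _ hint]
  exact integral_congr_ae <| ae_of_all _ fun x =>
    integral_thresholdSpin (p x) fun a => f (update x i a)

theorem measurePreserving_resample_iff (hp : Measurable p) (μ : Measure (ι → ℤˣ))
    [IsFiniteMeasure μ] :
    MeasurePreserving (resample i p) (μ.prod volume) μ ↔
      ∀ f : C(ι → ℤˣ, ℝ), ∫ x, heatBath i p f x ∂μ = ∫ x, f x ∂μ := by
  have hmeas := measurable_resample i hp
  simp only [← integral_comp_resample hp μ]
  refine ⟨fun h f => ?_, fun h => ⟨hmeas, ?_⟩⟩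
  · rw [← integral_map hmeas.aemeasurable f.continuous.aestronglyMeasurable, h.map_eq]
  · refine ext_of_forall_integral_eq_of_IsFiniteMeasure fun f => ?_
    rw [integral_map hmeas.aemeasurable f.continuous.aestronglyMeasurable]
    exact h f.toContinuousMap

theorem isClosed_setOf_measurePreserving_resample (i : ι) (hp : Continuous p) :
    IsClosed {μ : ProbabilityMeasure (ι → ℤˣ) |
      MeasurePreserving (resample i p) (μ.toMeasure.prod volume) μ.toMeasure} := by
  simp only [measurePreserving_resample_iff hp.measurable, ofPred_forall]
  exact isClosed_iInter fun f => isClosed_eq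
    (ProbabilityMeasure.continuous_integral_continuousMap
      (⟨_, continuous_heatBath i hp f.continuous⟩ : C(ι → ℤˣ, ℝ)))
    (ProbabilityMeasure.continuous_integral_continuousMap f)

/-- The Gibbs measure with density proportional to `exp H` with respect to the product of the
uniform laws of the spins. -/
noncomputable def gibbsMeasure (H : C(ι → ℤˣ, ℝ)) : Measure (ι → ℤˣ) :=
  (Measure.haarMeasure ⊤).tilted H

instance isProbabilityMeasure_gibbsMeasure (H : C(ι → ℤˣ, ℝ)) :
    IsProbabilityMeasure (gibbsMeasure H) := by
  have hexp : Continuous fun x => Real.exp (H x) := by fun_prop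
  exact isProbabilityMeasure_tilted (hexp.integrable_of_hasCompactSupport (.of_compactSpace _))

omit [Countable ι] in
theorem exp_add_exp_flip_mul_heatBath {H : (ι → ℤˣ) → ℝ} (f : (ι → ℤˣ) → ℝ)
    (hp : ∀ x, p x = unitInterval.sigmoid (H (update x i 1) - H (update x i (-1)))) (x : ι → ℤˣ) :
    (Real.exp (H x) + Real.exp (H (update x i (-x i)))) * heatBath i p f x =
      Real.exp (H x) * f x + Real.exp (H (update x i (-x i))) * f (update x i (-x i)) := by
  have hval : (p x : ℝ) = Real.exp (H (update x i 1)) /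
      (Real.exp (H (update x i 1)) + Real.exp (H (update x i (-1)))) := by
    rw [hp x]
    change (1 + Real.exp (-(_ - _)))⁻¹ = _
    rw [neg_sub, Real.exp_sub]
    field_simp
  rw [heatBath, hval]
  have hself := update_eq_self i x
  obtain hx | hx := Int.units_eq_one_or (x i) <;> rw [hx] at hself ⊢ <;>
    simp only [neg_neg, hself] <;> field_simp <;> ring

omit [Countable ι] in
theorem mulSingle_neg_one_mul (i : ι) (x : ι → ℤˣ) :
    Pi.mulSingle i (-1) * x = update x i (-x i) := by
  ext j
  obtain rfl | hj := eq_or_ne j i <;> simp [*]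

-- The flip of the spin at `i` preserves the Haar measure and negates `exp H * (heatBath f - f)`.
theorem integral_heatBath_gibbsMeasure {H : C(ι → ℤˣ, ℝ)}
    (hp : ∀ x, p x = unitInterval.sigmoid (H (update x i 1) - H (update x i (-1))))
    (f : C(ι → ℤˣ, ℝ)) :
    ∫ x, heatBath i p f x ∂gibbsMeasure H = ∫ x, f x ∂gibbsMeasure H := by
  have hpc : Continuous p := by
    rw [funext hp]
    exact unitInterval.continuous_sigmoid.comp (by fun_prop)
  have integrable_gibbs {g : (ι → ℤˣ) → ℝ} (hg : Continuous g) : Integrable g (gibbsMeasure H) :=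
    hg.integrable_of_hasCompactSupport (.of_compactSpace g)
  have heatBath_flip (x : ι → ℤˣ) : heatBath i p f (update x i (-x i)) = heatBath i p f x := by
    simp [heatBath, hp]
  rw [← sub_eq_zero, ← integral_sub (integrable_gibbs (continuous_heatBath i hpc f.continuous))
    (integrable_gibbs f.continuous), gibbsMeasure, integral_tilted]
  refine integral_eq_zero_of_mul_left_eq_neg (g := Pi.mulSingle i (-1)) fun x => ?_
  have hbalance := exp_add_exp_flip_mul_heatBath f hp x
  rw [mulSingle_neg_one_mul, heatBath_flip, smul_eq_mul, smul_eq_mul]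
  linear_combination (∫ y, Real.exp (H y) ∂Measure.haarMeasure ⊤)⁻¹ * hbalance

theorem measurePreserving_resample_gibbsMeasure {H : C(ι → ℤˣ, ℝ)}
    (hp : ∀ x, p x = unitInterval.sigmoid (H (update x i 1) - H (update x i (-1)))) :
    MeasurePreserving (resample i p) ((gibbsMeasure H).prod volume) (gibbsMeasure H) := by
  have hpm : Measurable p := by
    rw [funext hp]
    exact unitInterval.continuous_sigmoid.measurable.comp (by fun_prop)
  exact (measurePreserving_resample_iff hpm _).2 (integral_heatBath_gibbsMeasure hp)

end GibbsMeasure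

section Existence

variable {ι : Type*} [DecidableEq ι] {a : ι → ℝ}

omit [DecidableEq ι] in
theorem continuous_localField (ha : Summable a) : Continuous (localField a) :=
  continuous_tsum (fun j => by unfold spinVal; fun_prop) ha.abs fun j x => by simp

omit [DecidableEq ι] in
theorem continuous_plusProb (ha : Summable a) : Continuous (plusProb a) :=
  unitInterval.continuous_sigmoid.comp ((continuous_localField ha).const_mul 2)

theorem localField_update (ha : Summable a) (x : ι → ℤˣ) (k : ι) (s : ℤˣ) :
    localField a (update x k s) = localField a x + a k * (spinVal s - spinVal (x k)) := by
  have hsum := (summable_mul_spinVal ha x).hasSum.update k (a k * spinVal s)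
  have hupdate : (fun j => a j * spinVal (update x k s j)) =
      update (fun j => a j * spinVal (x j)) k (a k * spinVal s) := by
    ext j
    obtain rfl | hj := eq_or_ne j k <;> simp [*]
  rw [localField, hupdate, hsum.tsum_eq, localField]
  ring

theorem exists_energy {J : ι → ι → ℝ} (hdiag : ∀ i, J i i = 0) (hsymm : ∀ i j, J i j = J j i)
    (hsum : ∀ i, Summable (J i)) (Λ : Finset ι) :
    ∃ H : C(ι → ℤˣ, ℝ), ∀ i ∈ Λ, ∀ x,
      H (update x i 1) - H (update x i (-1)) = 2 * localField (J i) x := by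
  induction Λ using Finset.induction_on with
  | empty => exact ⟨0, by simp⟩
  | insert k Λ _ ih =>
    obtain ⟨H, hH⟩ := ih
    -- The new term has increment `2 * localField (J k)` under a flip at `k`, and by the symmetry
    -- of `J` it cancels the change in the increment at `i ∈ Λ` due to freezing the spin at `k`.
    have hcont : Continuous fun x : ι → ℤˣ =>
        H (update x k 1) + (spinVal (x k) - 1) * localField (J k) x := by
      have := continuous_localField (hsum k)
      unfold spinVal
      fun_prop
    refine ⟨⟨_, hcont⟩, fun i hi x => ?_⟩
    obtain rfl | hik := eq_or_ne i k
    · simp only [ContinuousMap.coe_mk, update_idem, update_self, localField_update (hsum i), hdiag,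
        spinVal_one, spinVal_neg]
      ring
    · have hHi := hH i (Finset.mem_of_mem_insert_of_ne hi hik) (update x k 1)
      rw [update_comm hik.symm, update_comm hik.symm, localField_update (hsum i)] at hHi
      simp only [ContinuousMap.coe_mk, update_of_ne hik.symm, localField_update (hsum k), hsymm k i,
        spinVal_one, spinVal_neg] at hHi ⊢
      linear_combination hHi

theorem exists_isHeatBathStationary [Countable ι] {J : ι → ι → ℝ} (hdiag : ∀ i, J i i = 0)
    (hsymm : ∀ i j, J i j = J j i) (hsum : ∀ i, Summable (J i)) :
    ∃ μ : ProbabilityMeasure (ι → ℤˣ),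
      IsHeatBathStationary (fun i => plusProb (J i)) μ.toMeasure := by
  obtain ⟨μ, hμ⟩ := CompactSpace.iInter_nonempty
    (fun i => isClosed_setOf_measurePreserving_resample i (continuous_plusProb (hsum i)))
    fun Λ => by
      obtain ⟨H, hH⟩ := exists_energy hdiag hsymm hsum Λ
      exact ⟨⟨gibbsMeasure H, inferInstance⟩, mem_iInter₂.2 fun i hi =>
        measurePreserving_resample_gibbsMeasure fun x => by rw [plusProb, hH i hi x]⟩
  exact ⟨μ, fun i => mem_iInter.1 hμ i⟩

end Existence

section IsingLaw

theorem condExp_indicator_one_ae_eq_iff {Ω : Type*} {m m0 : MeasurableSpace Ω} {μ : Measure Ω}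
    [IsFiniteMeasure μ] (hm : m ≤ m0) {s : Set Ω} (hs : MeasurableSet s) {f : Ω → ℝ}
    (hf : Integrable f μ) (hfm : StronglyMeasurable[m] f) :
    μ⟦s | m⟧ =ᵐ[μ] f ↔ ∀ A, MeasurableSet[m] A → ∫ x in A, f x ∂μ = μ.real (A ∩ s) := by
  have hint : Integrable (s.indicator fun _ => (1 : ℝ)) μ := (integrable_const 1).indicator hs
  have hreal (A : Set Ω) : ∫ x in A, s.indicator (fun _ => (1 : ℝ)) x ∂μ = μ.real (A ∩ s) := by
    rw [setIntegral_indicator hs, setIntegral_const, smul_eq_mul, mul_one]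
  refine ⟨fun h A hA => ?_, fun h => ?_⟩
  · rw [← hreal, ← setIntegral_condExp hm hint hA]
    exact integral_congr_ae (ae_restrict_of_ae h.symm)
  · exact (ae_eq_condExp_of_forall_setIntegral_eq hm hint (fun _ _ _ => hf.integrableOn)
      (fun A hA _ => (h A hA).trans (hreal A).symm) hfm.aestronglyMeasurable).symm

variable {d : ℕ} {i : Site d}

theorem offSite_le (i : Site d) : offSite i ≤ MeasurableSpace.pi :=
  Measurable.comap_le (by fun_prop)

theorem measurable_update_offSite (i : Site d) (a : ℤˣ) :
    Measurable[offSite i] fun x : Config d => update x i a := by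
  refine @measurable_pi_lambda _ _ _ (offSite i) _ _ fun j => ?_
  obtain rfl | hj := eq_or_ne j i
  · simp only [update_self]
    exact @measurable_const _ _ _ (offSite j) a
  · simp only [update_of_ne hj]
    exact (measurable_pi_apply (X := fun _ : {j // j ≠ i} => ℤˣ) ⟨j, hj⟩).comp (comap_measurable _)

theorem update_mem_iff_of_measurableSet_offSite {A : Set (Config d)}
    (hA : MeasurableSet[offSite i] A) (x : Config d) (a : ℤˣ) : update x i a ∈ A ↔ x ∈ A := by
  obtain ⟨B, _, rfl⟩ := hA
  have : (fun j : {j // j ≠ i} => update x i a j) = fun j : {j // j ≠ i} => x j :=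
    funext fun j => update_of_ne j.2 a x
  rw [mem_preimage, mem_preimage, this]

theorem ext_of_forall_offSite_inter {μ ν : Measure (Config d)} (i : Site d)
    (h : ∀ a A, MeasurableSet[offSite i] A → μ (A ∩ {x | x i = a}) = ν (A ∩ {x | x i = a})) :
    μ = ν := by
  have hspin (a : ℤˣ) : MeasurableSet {x : Config d | x i = a} :=
    (measurableSet_singleton a).preimage (measurable_pi_apply i)
  have hcompl : {x : Config d | x i = 1}ᶜ = {x | x i = -1} := by
    ext x
    exact Int.units_ne_iff_eq_neg
  have inter_spin (B : Set (Config d)) (a : ℤˣ) :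
      B ∩ {x | x i = a} = (update · i a) ⁻¹' B ∩ {x | x i = a} := by
    ext x
    refine and_congr_left fun hx => ?_
    rw [mem_preimage, ← show x i = a from hx, update_eq_self]
  ext B hB
  have hinter (a : ℤˣ) : μ (B ∩ {x | x i = a}) = ν (B ∩ {x | x i = a}) := by
    rw [inter_spin]
    exact h a _ (measurable_update_offSite i a hB)
  rw [← measure_inter_add_sdiff B (hspin 1), ← measure_inter_add_sdiff B (hspin 1), sdiff_eq,
    hcompl, hinter, hinter]

theorem real_resample_preimage_inter {p : Config d → I} (hp : Measurable p)
    (μ : Measure (Config d)) [SFinite μ] {A : Set (Config d)} (hA : MeasurableSet[offSite i] A)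
    (a : ℤˣ) :
    (μ.prod volume).real (resample i p ⁻¹' (A ∩ {x | x i = a})) =
      ∫ x in A, volume.real {u | thresholdSpin (p x) u = a} ∂μ := by
  have hmeas : MeasurableSet {z : Config d × I | thresholdSpin (p z.1) z.2 = a} :=
    (measurableSet_singleton a).preimage <|
      measurable_thresholdSpin.comp ((hp.comp measurable_fst).prodMk measurable_snd)
  have hpre : resample i p ⁻¹' (A ∩ {x | x i = a}) =
      Prod.fst ⁻¹' A ∩ {z | thresholdSpin (p z.1) z.2 = a} := by
    ext z
    simp [resample, update_mem_iff_of_measurableSet_offSite hA]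
  have hprod : (μ.prod (volume : Measure I)).restrict (Prod.fst ⁻¹' A) =
      (μ.restrict A).prod volume := by
    rw [← prod_univ, ← Measure.prod_restrict, Measure.restrict_univ]
  rw [hpre, measureReal_def, inter_comm, ← Measure.restrict_apply hmeas, hprod,
    Measure.prod_apply hmeas]
  exact (integral_toReal (measurable_measure_prodMk_left hmeas).aemeasurable
    (ae_of_all _ fun x => measure_lt_top _ _)).symm

theorem localSpec_eq_sigmoid (J : Site d → Site d → ℝ) (i : Site d) (a : ℤˣ) (x : Config d) :
    localSpec J i a x = Real.sigmoid (spinVal a * (2 * localField (J i) x)) := by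
  have hsum : ∑' j, J i j * spinVal a * spinVal (x j) = spinVal a * localField (J i) x := by
    rw [localField, ← tsum_mul_left]
    exact tsum_congr fun j => by ring
  rw [localSpec, hsum, Real.sigmoid_def, one_div]
  ring_nf

theorem volume_real_thresholdSpin_plusProb (J : Site d → Site d → ℝ) (i : Site d) (a : ℤˣ)
    (x : Config d) :
    volume.real {u | thresholdSpin (plusProb (J i) x) u = a} = localSpec J i a x := by
  rw [localSpec_eq_sigmoid]
  obtain rfl | rfl := Int.units_eq_one_or a
  · rw [volume_real_thresholdSpin_one, spinVal_one, one_mul]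
    rfl
  · rw [volume_real_thresholdSpin_neg_one, spinVal_neg, spinVal_one, neg_one_mul, Real.sigmoid_neg]
    rfl

variable {J : Site d → Site d → ℝ}

theorem continuous_localSpec (hsum : Summable (J i)) (a : ℤˣ) : Continuous (localSpec J i a) := by
  have := continuous_localField hsum
  rw [funext (localSpec_eq_sigmoid J i a)]
  fun_prop

theorem stronglyMeasurable_offSite_localSpec (hdiag : J i i = 0) (hsum : Summable (J i)) (a : ℤˣ) :
    StronglyMeasurable[offSite i] (localSpec J i a) := by
  have hupdate : localSpec J i a = fun x => localSpec J i a (update x i 1) := by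
    ext x
    rw [localSpec_eq_sigmoid, localSpec_eq_sigmoid, localField_update hsum, hdiag, zero_mul,
      add_zero]
  rw [hupdate]
  exact ((continuous_localSpec hsum a).measurable.comp
    (measurable_update_offSite i 1)).stronglyMeasurable

theorem isIsingLaw_iff_isHeatBathStationary (hdiag : ∀ i, J i i = 0) (hsum : ∀ i, Summable (J i))
    {μ : Measure (Config d)} [IsFiniteMeasure μ] :
    IsIsingLaw J μ ↔ IsHeatBathStationary (fun i => plusProb (J i)) μ := by
  refine forall_congr' fun i => ?_
  have hplus : Measurable (plusProb (J i)) := (continuous_plusProb (hsum i)).measurable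
  have hspin (a : ℤˣ) : MeasurableSet {x : Config d | x i = a} :=
    (measurableSet_singleton a).preimage (measurable_pi_apply i)
  have condProb_iff (a : ℤˣ) : μ⟦{x | x i = a} | offSite i⟧ =ᵐ[μ] localSpec J i a ↔
      ∀ A, MeasurableSet[offSite i] A →
        (μ.prod volume).real (resample i (plusProb (J i)) ⁻¹' (A ∩ {x | x i = a})) =
          μ.real (A ∩ {x | x i = a}) := by
    rw [condExp_indicator_one_ae_eq_iff (offSite_le i) (hspin a)
      ((continuous_localSpec (hsum i) a).integrable_of_hasCompactSupport (.of_compactSpace _))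
      (stronglyMeasurable_offSite_localSpec (hdiag i) (hsum i) a)]
    refine forall₂_congr fun A hA => ?_
    simp only [real_resample_preimage_inter hplus μ hA, volume_real_thresholdSpin_plusProb]
  have hresample := measurable_resample i hplus
  simp only [condProb_iff]
  refine ⟨fun h => ⟨hresample, ext_of_forall_offSite_inter i fun a A hA => ?_⟩, fun h a A hA => ?_⟩
  · rw [Measure.map_apply hresample ((offSite_le i A hA).inter (hspin a))]
    exact (measureReal_eq_measureReal_iff).1 (h a A hA)
  · exact congrArg ENNReal.toReal
      (h.measure_preimage ((offSite_le i A hA).inter (hspin a)).nullMeasurableSet)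

end IsingLaw

section IsingModel

variable {d : ℕ} {J K : Site d → Site d → ℝ}

theorem exists_isIsingLaw (hJ : IsPairwisePotential J) :
    ∃ μ : Measure (Config d), IsProbabilityMeasure μ ∧ IsIsingLaw J μ := by
  have hsum (i : Site d) : Summable (J i) := (hJ.summable i).of_abs
  obtain ⟨μ, hμ⟩ := exists_isHeatBathStationary hJ.diag hJ.symm hsum
  exact ⟨μ, inferInstance, (isIsingLaw_iff_isHeatBathStationary hJ.diag hsum).2 hμ⟩

theorem bddAbove_range_tsum_abs_sub (hJ : IsPairwisePotential J) (hK : IsPairwisePotential K) :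
    BddAbove (range fun i => ∑' j, |J i j - K i j|) := by
  obtain ⟨B, hB⟩ := hJ.bdd
  obtain ⟨C, hC⟩ := hK.bdd
  refine ⟨B + C, forall_mem_range.2 fun i => ?_⟩
  calc ∑' j, |J i j - K i j|
    _ ≤ ∑' j, (|J i j| + |K i j|) :=
        ((hJ.summable i).of_abs.sub (hK.summable i).of_abs).abs.tsum_le_tsum
          (fun j => abs_sub _ _) ((hJ.summable i).add (hK.summable i))
    _ = ∑' j, |J i j| + ∑' j, |K i j| := (hJ.summable i).tsum_add (hK.summable i)
    _ ≤ B + C := add_le_add (hB (mem_range_self i)) (hC (mem_range_self i))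

theorem abs_truncPotential_le (L : ℕ) (J : Site d → Site d → ℝ) (i j : Site d) :
    |truncPotential L J i j| ≤ |J i j| := by
  rw [truncPotential]
  split_ifs <;> simp

theorem isPairwisePotential_truncPotential (hJ : IsPairwisePotential J) (L : ℕ) :
    IsPairwisePotential (truncPotential L J) := by
  have hsum (i : Site d) : Summable fun j => |truncPotential L J i j| :=
    (hJ.summable i).of_nonneg_of_le (fun _ => abs_nonneg _) (abs_truncPotential_le L J i)
  refine ⟨fun i => ?_, fun i j => ?_, hsum, ?_⟩
  · rw [truncPotential, hJ.diag, ite_self]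
  · simp only [truncPotential, siteBall, mem_ofPred_eq, norm_sub_rev i j, hJ.symm i j]
    congr
  · exact hJ.bdd.range_mono _ fun i =>
      (hsum i).tsum_le_tsum (abs_truncPotential_le L J i) (hJ.summable i)

theorem tsum_abs_sub_truncPotential (J : Site d → Site d → ℝ) (L : ℕ) (i : Site d) :
    ∑' j, |J i j - truncPotential L J i j| = ∑' j : ↥((siteBall L i)ᶜ), |J i j| := by
  rw [tsum_subtype ((siteBall L i)ᶜ) fun j => |J i j|]
  refine tsum_congr fun j => ?_
  by_cases h : j ∈ siteBall L i <;> simp [truncPotential, h]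

end IsingModel

end

theorem mainTheorem3_general {d : ℕ} (J K : Site d → Site d → ℝ) (hJ : IsPairwisePotential J)
    (hK : IsPairwisePotential K) (r : ℝ) (hr : ⨆ i : Site d, ∑' j : Site d, |J i j| = r)
    (hr1 : r < 1) :
    (∃ μ : Measure (Config d), IsProbabilityMeasure μ ∧ IsIsingLaw J μ) ∧
    (∃ ν : Measure (Config d), IsProbabilityMeasure ν ∧ IsIsingLaw K ν) ∧
    ∀ {Ω Ω' : Type*} [MeasurableSpace Ω] [MeasurableSpace Ω']
      (P : Measure Ω) (P' : Measure Ω') [IsProbabilityMeasure P] [IsProbabilityMeasure P']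
      (X : Ω → Config d) (Y : Ω' → Config d), IsIsingModel J P X → IsIsingModel K P' Y →
      ∃ (Ω₀ : Type) (_ : MeasurableSpace Ω₀) (Q : Measure Ω₀) (Z : Ω₀ → Config d × Config d),
        IsProbabilityMeasure Q ∧ IsCoupling P X P' Y Q Z ∧
        ∀ i : Site d, Q.real {ω | (Z ω).1 i ≠ (Z ω).2 i} ≤
          1 / (1 - r) * ⨆ k : Site d, ∑' j : Site d, |J k j - K k j| := by
  refine ⟨exists_isIsingLaw hJ, exists_isIsingLaw hK, ?_⟩
  intro Ω Ω' _ _ P P' _ _ X Y hX hY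
  have hJsum (i : Site d) : Summable (J i) := (hJ.summable i).of_abs
  have hKsum (i : Site d) : Summable (K i) := (hK.summable i).of_abs
  let μ : ProbabilityMeasure (Config d) :=
    ⟨P.map X, Measure.isProbabilityMeasure_map hX.1.aemeasurable⟩
  let ν : ProbabilityMeasure (Config d) :=
    ⟨P'.map Y, Measure.isProbabilityMeasure_map hY.1.aemeasurable⟩
  obtain ⟨π, ⟨hfst, hsnd⟩, hle⟩ := exists_mem_couplings_real_disagreeAt_le (μ := μ) (ν := ν)
    hJsum hKsum (fun i => hr ▸ le_ciSup hJ.bdd i) hr1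
    (le_ciSup (bddAbove_range_tsum_abs_sub hJ hK))
    ((isIsingLaw_iff_isHeatBathStationary hJ.diag hJsum).1 hX.2)
    ((isIsingLaw_iff_isHeatBathStationary hK.diag hKsum).1 hY.2)
  exact ⟨Config d × Config d, inferInstance, π.toMeasure, id, inferInstance,
    ⟨measurable_id, hfst.map_eq, hsnd.map_eq⟩, hle⟩

theorem mainTheorem3 {d : ℕ} (L : ℕ) (hL : 1 ≤ L) (J : Site d → Site d → ℝ)
    (hJ : IsPairwisePotential J) (r : ℝ) (hr : ⨆ i : Site d, ∑' j : Site d, |J i j| = r)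
    (hr1 : r < 1) :
    (∃ μ : Measure (Config d), IsProbabilityMeasure μ ∧ IsIsingLaw J μ) ∧
    (∃ ν : Measure (Config d), IsProbabilityMeasure ν ∧ IsIsingLaw (truncPotential L J) ν) ∧
    ∀ {Ω Ω' : Type*} [MeasurableSpace Ω] [MeasurableSpace Ω']
      (P : Measure Ω) (P' : Measure Ω') [IsProbabilityMeasure P] [IsProbabilityMeasure P']
      (X : Ω → Config d) (Y : Ω' → Config d),
      IsIsingModel J P X → IsIsingModel (truncPotential L J) P' Y →
      ∃ (Ω₀ : Type) (_ : MeasurableSpace Ω₀) (Q : Measure Ω₀) (Z : Ω₀ → Config d × Config d),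
        IsProbabilityMeasure Q ∧ IsCoupling P X P' Y Q Z ∧
        ∀ i : Site d, Q.real {ω | (Z ω).1 i ≠ (Z ω).2 i} ≤
          1 / (1 - r) * ⨆ k : Site d, ∑' j : ↥((siteBall L k)ᶜ), |J k j| := by
  simpa only [tsum_abs_sub_truncPotential] using
    mainTheorem3_general J _ hJ (isPairwisePotential_truncPotential hJ L) r hr hr1
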